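/- Let $n\ge 0$, $m\ge 1$, and let $F=(F_1,\dots,F_m):\mathbb{R}^n\to\mathbb{R}^m$ be continuously differentiable. Let $\|\cdot\|$ be the Euclidean norm, $\Delta_m=\{\lambda\in\mathbb{R}^m : \lambda_j\ge 0 \text{ for all } j,\ \sum_{j=1}^m\lambda_j=1\}$, and $$\mathcal{D}(x,d)=\max_{1\le j\le m}\nabla F_j(x)^\top d .$$ A point $x$ is *Pareto critical* if the image of the Jacobian $JF(x)$ contains no vector all of whose components are negative. The steepest descent direction is $$d_{SD}(x)=\arg\min_{d\in\mathbb{R}^n}\ \max_{1\le j\le m}\nabla F_j(x)^\top d+\tfrac12\|d\|^2 .$$ Let $x^0\in\mathbb{R}^n$ and assume that the level set $\mathcal{L}=\{x : F_j(x)\le F_j(x^0)\ \text{for all } j\}$ is bounded, and that there are an open set $\mathcal{N}\supseteq\mathcal{L}$ and a constant $L\ge 0$ such that $\|\nabla F_j(x)-\nabla F_j(y)\|\le L\|x-y\|$ for all $x,y\in\mathcal{N}$ and all $j$. No convexity is assumed. Let $\rho\in(0,1/2)$, $\sigma\in(\rho,1)$, $0<\underline\vartheta\le\bar\vartheta$,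 and let $B_1^0,\dots,B_m^0\in\mathbb{R}^{n\times n}$ be symmetric positive definite. Let $\{x^k\}_{k\ge 0}$ be an infinite sequence generated from $x^0$ by the following modified BFGS algorithm; that is, no $x^k$ is Pareto critical (the algorithm stops at a Pareto critical iterate), and for every $k\ge 0$: 1. $d^k=\arg\min_{d\in\mathbb{R}^n}\max_{1\le j\le m}\big(\nabla F_j(x^k)^\top d+\tfrac12 d^\top B_j^k d\big)$; 2. $x^{k+1}=x^k+\alpha_k d^k$, where $\alpha_k>0$ satisfies the Wolfe conditions $$F_j(x^k+\alpha_kd^k)\le F_j(x^k)+\rho\,\alpha_k\,\mathcal{D}(x^k,d^k)\quad (1\le j\le m),\qquad \mathcal{D}(x^k+\alpha_kd^k,d^k)\ge\sigma\,\mathcal{D}(x^k,d^k);$$ 3. with $s^k=x^{k+1}-x^k$, $y_j^k=\nabla F_j(x^{k+1})-\nabla F_j(x^k)$, $\eta_j^k=(y_j^k)^\top s^k/\|s^k\|^2$, some $\mu^k\in\Delta_m$ and some $\vartheta_k\in[\underline\vartheta,\bar\vartheta]$, one sets for each $j$ $$r_j^k=\max\{-\eta_j^k,0\}+\vartheta_k\Big\|\sum_{i=1}^m\mu_i^k\nabla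 F_i(x^k)\Big\|,\qquad \gamma_j^k=y_j^k+r_j^ks^k,$$ $$B_j^{k+1}=B_j^k-\frac{B_j^ks^k(s^k)^\top B_j^k}{(s^k)^\top B_j^ks^k}+\frac{\gamma_j^k(\gamma_j^k)^\top}{(\gamma_j^k)^\top s^k}.$$ Then $$\liminf_{k\to\infty}\|d_{SD}(x^k)\|=0 ,$$ and there is a subsequence of $\{x^k\}$ that converges to a Pareto critical point of $F$. -/

import Mathlib

open Filter Topology
open scoped Matrix

namespace MOBFGS

/-- The gradient `∇F_j(x)` of the `j`-th component of `F : ℝⁿ → ℝᵐ`. -/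
noncomputable def grad {n m : ℕ} (F : EuclideanSpace ℝ (Fin n) → EuclideanSpace ℝ (Fin m))
    (j : Fin m) (x : EuclideanSpace ℝ (Fin n)) : EuclideanSpace ℝ (Fin n) :=
  gradient (fun z => F z j) x

/-- `x` is Pareto critical: the image of the Jacobian `JF(x)` does not meet the open negative
orthant. -/
def IsParetoCritical {n m : ℕ} (F : EuclideanSpace ℝ (Fin n) → EuclideanSpace ℝ (Fin m))
    (x : EuclideanSpace ℝ (Fin n)) : Prop :=
  {v : EuclideanSpace ℝ (Fin m) | ∀ j, v j < 0} ∩ Set.range (fderiv ℝ F x) = ∅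

/-- The level set `{x | F(x) ≤ F(x₀)}`, with the componentwise order. -/
def levelSet {n m : ℕ} (F : EuclideanSpace ℝ (Fin n) → EuclideanSpace ℝ (Fin m))
    (x₀ : EuclideanSpace ℝ (Fin n)) : Set (EuclideanSpace ℝ (Fin n)) :=
  {x | ∀ j, F x j ≤ F x₀ j}

/-- `𝒟(x, d) = max_j ∇F_j(x)ᵀ d` (a maximum over a finite index set, nonempty for `0 < m`). -/
noncomputable def maxDeriv {n m : ℕ}
    (F : EuclideanSpace ℝ (Fin n) → EuclideanSpace ℝ (Fin m))
    (x d : EuclideanSpace ℝ (Fin n)) : ℝ :=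
  ⨆ j : Fin m, inner ℝ (grad F j x) d

/-- The objective `d ↦ max_j (∇F_j(x)ᵀ d + ½ dᵀ B_j d)` of the direction subproblem. -/
noncomputable def subObjective {n m : ℕ}
    (F : EuclideanSpace ℝ (Fin n) → EuclideanSpace ℝ (Fin m))
    (B : Fin m → Matrix (Fin n) (Fin n) ℝ) (x d : EuclideanSpace ℝ (Fin n)) : ℝ :=
  ⨆ j : Fin m, (inner ℝ (grad F j x) d + (1 / 2) * (d.ofLp ⬝ᵥ (B j *ᵥ d.ofLp)))

/-- The direction `d(x) = argmin_d max_j (∇F_j(x)ᵀ d + ½ dᵀ B_j d)`. For `0 < m` and positive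
definite `B_j` the minimizer exists and is unique, see `isMinOn_iff_eq_searchDir`. -/
noncomputable def searchDir {n m : ℕ}
    (F : EuclideanSpace ℝ (Fin n) → EuclideanSpace ℝ (Fin m))
    (B : Fin m → Matrix (Fin n) (Fin n) ℝ) (x : EuclideanSpace ℝ (Fin n)) :
    EuclideanSpace ℝ (Fin n) :=
  Classical.epsilon fun d => IsMinOn (subObjective F B x) Set.univ d

/-- The steepest descent direction `d_SD(x) = argmin_d max_j ∇F_j(x)ᵀ d + ½ ‖d‖²`, which is the
direction obtained with `B_j = I` for all `j`. -/
noncomputable def steepestDir {n m : ℕ}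
    (F : EuclideanSpace ℝ (Fin n) → EuclideanSpace ℝ (Fin m))
    (x : EuclideanSpace ℝ (Fin n)) : EuclideanSpace ℝ (Fin n) :=
  searchDir F (fun _ => 1) x

/-- With `B_j = I` the subproblem objective is `max_j ∇F_j(x)ᵀ d + ½ ‖d‖²`. -/
theorem subObjective_one {n m : ℕ} (hm : 0 < m)
    (F : EuclideanSpace ℝ (Fin n) → EuclideanSpace ℝ (Fin m)) (x d : EuclideanSpace ℝ (Fin n)) :
    subObjective F (fun _ => 1) x d = maxDeriv F x d + (1 / 2) * ‖d‖ ^ 2 := by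
  have : Nonempty (Fin m) := ⟨⟨0, hm⟩⟩
  have h : d.ofLp ⬝ᵥ d.ofLp = ‖d‖ ^ 2 := by
    rw [EuclideanSpace.real_norm_sq_eq]
    simp [dotProduct, sq]
  unfold subObjective maxDeriv
  simp only [Matrix.one_mulVec, h]
  rw [ciSup_add (Set.finite_range _).bddAbove]

theorem le_subObjective {n m : ℕ}
    (F : EuclideanSpace ℝ (Fin n) → EuclideanSpace ℝ (Fin m))
    (B : Fin m → Matrix (Fin n) (Fin n) ℝ) (x d : EuclideanSpace ℝ (Fin n)) (j : Fin m) :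
    inner ℝ (grad F j x) d + (1 / 2) * (d.ofLp ⬝ᵥ (B j *ᵥ d.ofLp)) ≤ subObjective F B x d :=
  le_ciSup (f := fun j : Fin m =>
    inner ℝ (grad F j x) d + (1 / 2) * (d.ofLp ⬝ᵥ (B j *ᵥ d.ofLp)))
    (Set.finite_range _).bddAbove j

theorem continuous_subObjective {n m : ℕ} (hm : 0 < m)
    (F : EuclideanSpace ℝ (Fin n) → EuclideanSpace ℝ (Fin m))
    (B : Fin m → Matrix (Fin n) (Fin n) ℝ) (x : EuclideanSpace ℝ (Fin n)) :
    Continuous (subObjective F B x) := by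
  have : Nonempty (Fin m) := ⟨⟨0, hm⟩⟩
  have h : subObjective F B x = fun d => Finset.univ.sup' Finset.univ_nonempty
      (fun j : Fin m => inner ℝ (grad F j x) d + (1 / 2) * (d.ofLp ⬝ᵥ (B j *ᵥ d.ofLp))) := by
    funext d
    rw [Finset.sup'_univ_eq_ciSup]
    rfl
  rw [h]
  refine Continuous.finset_sup'_apply _ fun j _ => ?_
  have h1 : Continuous fun d : EuclideanSpace ℝ (Fin n) => d.ofLp ⬝ᵥ (B j *ᵥ d.ofLp) :=
    Continuous.dotProduct (PiLp.continuous_ofLp 2 _)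
      (Continuous.matrix_mulVec continuous_const (PiLp.continuous_ofLp 2 _))
  exact (continuous_const.inner continuous_id).add (continuous_const.mul h1)

theorem exists_coercive {n : ℕ} {A : Matrix (Fin n) (Fin n) ℝ} (hA : A.PosDef) :
    ∃ c > 0, ∀ d : EuclideanSpace ℝ (Fin n), c * ‖d‖ ^ 2 ≤ d.ofLp ⬝ᵥ (A *ᵥ d.ofLp) := by
  have hc : Continuous fun d : EuclideanSpace ℝ (Fin n) => d.ofLp ⬝ᵥ (A *ᵥ d.ofLp) :=
    Continuous.dotProduct (PiLp.continuous_ofLp 2 _)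
      (Continuous.matrix_mulVec continuous_const (PiLp.continuous_ofLp 2 _))
  have hpos : ∀ d : EuclideanSpace ℝ (Fin n), d ≠ 0 → 0 < d.ofLp ⬝ᵥ (A *ᵥ d.ofLp) := by
    intro d hd
    have h0 : d.ofLp ≠ 0 := fun h => hd (by ext i; simpa using congrFun h i)
    simpa using hA.dotProduct_mulVec_pos h0
  rcases (Metric.sphere (0 : EuclideanSpace ℝ (Fin n)) 1).eq_empty_or_nonempty with he | hne
  · refine ⟨1, one_pos, fun d => ?_⟩
    have hd : d = 0 := by
      by_contra hd
      have : (‖d‖⁻¹ • d) ∈ Metric.sphere (0 : EuclideanSpace ℝ (Fin n)) 1 := by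
        simp [norm_smul, norm_ne_zero_iff.mpr hd]
      rw [he] at this
      exact this
    simp [hd]
  · obtain ⟨u, hu, hmin⟩ := (isCompact_sphere _ _).exists_isMinOn hne hc.continuousOn
    have hu1 : ‖u‖ = 1 := by simpa using hu
    refine ⟨_, hpos u (by intro h; simp [h] at hu1), fun d => ?_⟩
    by_cases hd : d = 0
    · simp [hd]
    have hn : ‖d‖ ≠ 0 := norm_ne_zero_iff.mpr hd
    have hs : (‖d‖⁻¹ • d) ∈ Metric.sphere (0 : EuclideanSpace ℝ (Fin n)) 1 := by
      simp [norm_smul, hn]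
    have h := hmin hs
    simp only [Set.mem_ofPred_eq, WithLp.ofLp_smul, Matrix.mulVec_smul, dotProduct_smul,
      smul_dotProduct, smul_eq_mul] at h
    calc _ ≤ (‖d‖⁻¹ * (‖d‖⁻¹ * (d.ofLp ⬝ᵥ (A *ᵥ d.ofLp)))) * ‖d‖ ^ 2 :=
          mul_le_mul_of_nonneg_right h (sq_nonneg _)
      _ = _ := by field_simp

/-- For `0 < m` and positive definite `B_j` the direction subproblem has exactly one solution. -/
theorem existsUnique_isMinOn {n m : ℕ} (hm : 0 < m)
    (F : EuclideanSpace ℝ (Fin n) → EuclideanSpace ℝ (Fin m))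
    (B : Fin m → Matrix (Fin n) (Fin n) ℝ) (hB : ∀ j, (B j).PosDef)
    (x : EuclideanSpace ℝ (Fin n)) :
    ∃! d, IsMinOn (subObjective F B x) Set.univ d := by
  have : Nonempty (Fin m) := ⟨⟨0, hm⟩⟩
  have hcont := continuous_subObjective hm F B x
  have hex : ∃ d, ∀ d', subObjective F B x d ≤ subObjective F B x d' := by
    let j₀ : Fin m := ⟨0, hm⟩
    obtain ⟨c, hc, hcd⟩ := exists_coercive (hB j₀)
    refine hcont.exists_forall_le ?_
    have hlow : ∀ d : EuclideanSpace ℝ (Fin n),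
        ‖d‖ * ((c / 2) * ‖d‖ - ‖grad F j₀ x‖) ≤ subObjective F B x d := by
      intro d
      have h1 := le_subObjective F B x d j₀
      have h2 := hcd d
      have h3 := (abs_le.mp (abs_real_inner_le_norm (grad F j₀ x) d)).1
      nlinarith
    refine tendsto_atTop_mono hlow ?_
    have hn : Tendsto (fun d : EuclideanSpace ℝ (Fin n) => ‖d‖) (cocompact _) atTop :=
      tendsto_norm_cocompact_atTop
    refine hn.atTop_mul_atTop₀ ?_
    exact tendsto_atTop_add_const_right _ _ (hn.const_mul_atTop (by positivity))
  obtain ⟨d, hd⟩ := hex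
  refine ⟨d, fun d' _ => hd d', fun e he => ?_⟩
  have he' : ∀ d', subObjective F B x e ≤ subObjective F B x d' := fun d' => he (Set.mem_univ d')
  by_contra hne
  obtain ⟨j, hj⟩ := exists_eq_ciSup_of_finite (f := fun j : Fin m =>
    inner ℝ (grad F j x) ((1 / 2 : ℝ) • (d + e)) + (1 / 2) *
      (((1 / 2 : ℝ) • (d + e)).ofLp ⬝ᵥ (B j *ᵥ ((1 / 2 : ℝ) • (d + e)).ofLp)))
  have hmid : inner ℝ (grad F j x) ((1 / 2 : ℝ) • (d + e)) + (1 / 2) *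
      (((1 / 2 : ℝ) • (d + e)).ofLp ⬝ᵥ (B j *ᵥ ((1 / 2 : ℝ) • (d + e)).ofLp))
        = subObjective F B x ((1 / 2 : ℝ) • (d + e)) := hj
  have h1 := le_subObjective F B x d j
  have h2 := le_subObjective F B x e j
  have h3 := hd ((1 / 2 : ℝ) • (d + e))
  have h4 := he' ((1 / 2 : ℝ) • (d + e))
  have h5 : 0 < (d - e).ofLp ⬝ᵥ (B j *ᵥ (d - e).ofLp) := by
    obtain ⟨c, hc, hcd⟩ := exists_coercive (hB j)
    have : 0 < ‖d - e‖ := norm_pos_iff.mpr (sub_ne_zero.mpr (Ne.symm hne))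
    exact lt_of_lt_of_le (by positivity) (hcd (d - e))
  simp only [WithLp.ofLp_smul, WithLp.ofLp_add, WithLp.ofLp_sub, Matrix.mulVec_smul,
    Matrix.mulVec_add, Matrix.mulVec_sub, dotProduct_smul, smul_dotProduct, smul_eq_mul,
    dotProduct_add, add_dotProduct, dotProduct_sub, sub_dotProduct, inner_smul_right,
    inner_add_right] at hmid h5
  linarith

/-- For `0 < m` and positive definite `B_j`, `searchDir` is the unique solution of the direction
subproblem. -/
theorem isMinOn_iff_eq_searchDir {n m : ℕ} (hm : 0 < m)
    (F : EuclideanSpace ℝ (Fin n) → EuclideanSpace ℝ (Fin m))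
    (B : Fin m → Matrix (Fin n) (Fin n) ℝ) (hB : ∀ j, (B j).PosDef)
    (x d : EuclideanSpace ℝ (Fin n)) :
    IsMinOn (subObjective F B x) Set.univ d ↔ d = searchDir F B x := by
  have hu := existsUnique_isMinOn hm F B hB x
  have hs : IsMinOn (subObjective F B x) Set.univ (searchDir F B x) :=
    Classical.epsilon_spec hu.exists
  exact ⟨fun h => hu.unique h hs, fun h => h ▸ hs⟩

/-- `r_j = max {-η_j, 0} + ϑ ‖∑ᵢ μᵢ ∇Fᵢ(x)‖` for consecutive iterates `x`, `x'`, where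
`η_j = y_jᵀ s / ‖s‖²`, `s = x' - x` and `y_j = ∇F_j(x') - ∇F_j(x)`. -/
noncomputable def correction {n m : ℕ}
    (F : EuclideanSpace ℝ (Fin n) → EuclideanSpace ℝ (Fin m)) (μ : Fin m → ℝ) (ϑ : ℝ)
    (x x' : EuclideanSpace ℝ (Fin n)) (j : Fin m) : ℝ :=
  max (-(inner ℝ (grad F j x' - grad F j x) (x' - x) / ‖x' - x‖ ^ 2)) 0
    + ϑ * ‖∑ i, μ i • grad F i x‖

/-- `γ_j = y_j + r_j s` for consecutive iterates `x`, `x'`. -/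
noncomputable def gammaVec {n m : ℕ}
    (F : EuclideanSpace ℝ (Fin n) → EuclideanSpace ℝ (Fin m)) (μ : Fin m → ℝ) (ϑ : ℝ)
    (x x' : EuclideanSpace ℝ (Fin n)) (j : Fin m) : EuclideanSpace ℝ (Fin n) :=
  (grad F j x' - grad F j x) + correction F μ ϑ x x' j • (x' - x)

/-- The BFGS update `B - (B s sᵀ B) / (sᵀ B s) + (γ γᵀ) / (γᵀ s)`. -/
noncomputable def bfgsUpdate {n : ℕ} (B : Matrix (Fin n) (Fin n) ℝ) (s γ : Fin n → ℝ) :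
    Matrix (Fin n) (Fin n) ℝ :=
  B - (s ⬝ᵥ (B *ᵥ s))⁻¹ • (B * Matrix.vecMulVec s s * B)
    + (γ ⬝ᵥ s)⁻¹ • Matrix.vecMulVec γ γ

/-- `x`, `d`, `α`, `B`, `μ`, `ϑ` are the data of an infinite run of the modified BFGS algorithm for
`F` from the starting point `x₀`, with parameters `ρ`, `σ`, `ϑlo`, `ϑhi`. -/
structure IsRun {n m : ℕ} (F : EuclideanSpace ℝ (Fin n) → EuclideanSpace ℝ (Fin m))
    (ρ σ ϑlo ϑhi : ℝ) (x₀ : EuclideanSpace ℝ (Fin n))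
    (x d : ℕ → EuclideanSpace ℝ (Fin n)) (α : ℕ → ℝ)
    (B : ℕ → Fin m → Matrix (Fin n) (Fin n) ℝ) (μ : ℕ → Fin m → ℝ) (ϑ : ℕ → ℝ) : Prop where
  start : x 0 = x₀
  /-- The initial matrices are symmetric positive definite. -/
  posDef_zero : ∀ j, (B 0 j).PosDef
  /-- Step 1: search direction. -/
  direction : ∀ k, d k = searchDir F (B k) (x k)
  /-- Step 2: the stopping criterion is never met. -/
  not_critical : ∀ k, ¬ IsParetoCritical F (x k)
  /-- Step 3: a positive step size satisfying the two Wolfe conditions. -/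
  step_pos : ∀ k, 0 < α k
  wolfe_decrease : ∀ k j, F (x k + α k • d k) j ≤ F (x k) j + ρ * α k * maxDeriv F (x k) (d k)
  wolfe_curvature : ∀ k, σ * maxDeriv F (x k) (d k) ≤ maxDeriv F (x k + α k • d k) (d k)
  next : ∀ k, x (k + 1) = x k + α k • d k
  /-- Step 4: choice of the multipliers in the unit simplex and of the scaling. -/
  multiplier_mem : ∀ k, μ k ∈ stdSimplex ℝ (Fin m)
  scaling_mem : ∀ k, ϑ k ∈ Set.Icc ϑlo ϑhi
  /-- Step 5: update of the matrices. -/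
  update : ∀ k j, B (k + 1) j = bfgsUpdate (B k j) (x (k + 1) - x k).ofLp
    (gammaVec F (μ k) (ϑ k) (x k) (x (k + 1)) j).ofLp

end MOBFGS

/-!
The proof is by contradiction: suppose that `‖d_SD(xᵏ)‖ ≥ ε` for all large `k`.

*Wolfe conditions.* The iterates stay in the compact level set, the step sizes are bounded below
through the Lipschitz constant, and telescoping one objective gives the Zoutendijk condition
`𝒟(xᵏ, dᵏ)² / ‖dᵏ‖² → 0` (`IsRun.tendsto_zoutendijk`).

*BFGS updates.* The update is a congruence (`bfgsUpdate_eq_congruence`), hence preserves positive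
definiteness and multiplies the determinant by `γᵀs / sᵀBs`. For the potential
`ψ(B) = tr B - log det B ≥ 0` this yields
`ψ(B⁺) = ψ(B) - (‖Bs‖²/sᵀBs - log (sᵀBs/‖s‖²)) + (‖γ‖²/γᵀs - log (γᵀs/‖s‖²))`.
The convex combination of gradients in the correction has norm at least `‖d_SD(xᵏ)‖ ≥ ε`, so the
last bracket is bounded above. Summed over the objectives, the potentials stay nonnegative; hence
infinitely often the sum over `j` of the first brackets is below a fixed bound. As each of these
is nonnegative, this bounds all of them simultaneously
(`IsRun.exists_frequently_bfgsDefect_le`). No estimate of the proportion of such iterations is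
needed.

*Conclusion.* At such an iteration `‖Bⱼ d‖ ≤ M ‖d‖` and `dᵀBⱼd ≥ q ‖d‖²` for all `j`. First-order
optimality of `d`, tested against `d_SD`, turns the former into `ε ≤ ‖d_SD‖ ≤ M ‖d‖`
(`norm_steepestDir_le_mul_norm_searchDir`), and the latter gives `𝒟 ≤ -(q/2) ‖d‖²`. Thus
`𝒟² / ‖d‖²` is infinitely often bounded away from zero, contradicting the Zoutendijk condition.
A subsequence with `d_SD → 0` has a convergent subsequence by compactness, and its limit is Pareto
critical by first-order optimality (`isParetoCritical_of_tendsto`).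
-/

namespace MOBFGS

/-! ### The trace–determinant potential of the BFGS update -/

/-- The BFGS update is a congruence `(1 + u sᵀ) B (1 + u sᵀ)ᵀ`. This one identity gives both
positive definiteness and the determinant of the update. -/
theorem bfgsUpdate_eq_congruence {n : ℕ} {B : Matrix (Fin n) (Fin n) ℝ} (hB : Bᵀ = B)
    {s γ : Fin n → ℝ} (hs : 0 < s ⬝ᵥ (B *ᵥ s)) (hγ : 0 < γ ⬝ᵥ s) :
    bfgsUpdate B s γ =
      (1 + Matrix.vecMulVec ((√((γ ⬝ᵥ s) * (s ⬝ᵥ (B *ᵥ s))))⁻¹ • γ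
        - (s ⬝ᵥ (B *ᵥ s))⁻¹ • (B *ᵥ s)) s) * B *
      (1 + Matrix.vecMulVec ((√((γ ⬝ᵥ s) * (s ⬝ᵥ (B *ᵥ s))))⁻¹ • γ
        - (s ⬝ᵥ (B *ᵥ s))⁻¹ • (B *ᵥ s)) s)ᵀ := by
  have hsB : s ᵥ* B = B *ᵥ s := by
    conv_lhs => rw [← hB]
    rw [Matrix.vecMul_transpose]
  set w := B *ᵥ s with hw
  set β := s ⬝ᵥ w with hβ
  set τ := γ ⬝ᵥ s with hτ
  set c := (√(τ * β))⁻¹ with hc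
  have hc2 : β * c ^ 2 = τ⁻¹ := by
    rw [hc, inv_pow, Real.sq_sqrt (by positivity)]
    field_simp
  set u := c • γ - β⁻¹ • w with hu
  have h1 : (1 + Matrix.vecMulVec u s) * B * (1 + Matrix.vecMulVec u s)ᵀ
      = B + Matrix.vecMulVec u w + Matrix.vecMulVec w u + β • Matrix.vecMulVec u u := by
    have h2 : w ⬝ᵥ s = β := dotProduct_comm _ _
    simp only [Matrix.transpose_add, Matrix.transpose_one, Matrix.transpose_vecMulVec,
      Matrix.add_mul, Matrix.mul_add, Matrix.one_mul, Matrix.mul_one, Matrix.vecMulVec_mul, hsB,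
      Matrix.mul_vecMulVec, ← hw, Matrix.add_mulVec, Matrix.vecMulVec_mulVec, h2,
      Matrix.add_vecMulVec]
    ext i j
    simp [Matrix.vecMulVec_apply]
    ring
  rw [h1]
  ext i j
  simp only [bfgsUpdate, Matrix.mul_vecMulVec, Matrix.vecMulVec_mul, hsB, ← hw, ← hβ, ← hτ,
    Matrix.add_apply, Matrix.sub_apply, Matrix.smul_apply, Matrix.vecMulVec_apply, smul_eq_mul,
    hu, Pi.sub_apply, Pi.smul_apply, ← hc2]
  field_simp
  ring

theorem det_one_add_bfgsFactor {n : ℕ} {B : Matrix (Fin n) (Fin n) ℝ}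
    {s γ : Fin n → ℝ} (hs : 0 < s ⬝ᵥ (B *ᵥ s)) (hγ : 0 < γ ⬝ᵥ s) :
    (1 + Matrix.vecMulVec ((√((γ ⬝ᵥ s) * (s ⬝ᵥ (B *ᵥ s))))⁻¹ • γ
        - (s ⬝ᵥ (B *ᵥ s))⁻¹ • (B *ᵥ s)) s).det = √((γ ⬝ᵥ s) / (s ⬝ᵥ (B *ᵥ s))) := by
  rw [Matrix.vecMulVec_eq Unit, Matrix.det_one_add_replicateCol_mul_replicateRow,
    dotProduct_sub, dotProduct_smul, dotProduct_smul, dotProduct_comm s γ]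
  have h1 := Real.sqrt_pos.mpr hs
  have h2 := Real.sqrt_pos.mpr hγ
  rw [Real.sqrt_mul hγ.le, Real.sqrt_div hγ.le]
  simp only [smul_eq_mul]
  rw [inv_mul_cancel₀ hs.ne']
  field_simp
  rw [Real.sq_sqrt hγ.le]
  ring

theorem det_bfgsUpdate {n : ℕ} {B : Matrix (Fin n) (Fin n) ℝ} (hB : Bᵀ = B)
    {s γ : Fin n → ℝ} (hs : 0 < s ⬝ᵥ (B *ᵥ s)) (hγ : 0 < γ ⬝ᵥ s) :
    (bfgsUpdate B s γ).det = B.det * ((γ ⬝ᵥ s) / (s ⬝ᵥ (B *ᵥ s))) := by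
  rw [bfgsUpdate_eq_congruence hB hs hγ, Matrix.det_mul, Matrix.det_mul, Matrix.det_transpose,
    det_one_add_bfgsFactor hs hγ]
  have := Real.mul_self_sqrt (div_pos hγ hs).le
  linear_combination B.det * this

theorem posDef_bfgsUpdate {n : ℕ} {B : Matrix (Fin n) (Fin n) ℝ} (hB : B.PosDef)
    {s γ : Fin n → ℝ} (hs : 0 < s ⬝ᵥ (B *ᵥ s)) (hγ : 0 < γ ⬝ᵥ s) :
    (bfgsUpdate B s γ).PosDef := by
  have hT : Bᵀ = B := by simpa using hB.isHermitian.eq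
  rw [bfgsUpdate_eq_congruence hT hs hγ]
  have hdet := det_one_add_bfgsFactor hs hγ
  rw [← Matrix.conjTranspose_eq_transpose_of_trivial]
  refine hB.mul_mul_conjTranspose_same (Matrix.vecMul_injective_of_isUnit ?_)
  rw [Matrix.isUnit_iff_isUnit_det, hdet]
  exact (Real.sqrt_pos.mpr (div_pos hγ hs)).ne'.isUnit

theorem trace_bfgsUpdate {n : ℕ} {B : Matrix (Fin n) (Fin n) ℝ} (hB : Bᵀ = B)
    (s γ : Fin n → ℝ) :
    (bfgsUpdate B s γ).trace = B.trace
      - ((B *ᵥ s) ⬝ᵥ (B *ᵥ s)) / (s ⬝ᵥ (B *ᵥ s)) + (γ ⬝ᵥ γ) / (γ ⬝ᵥ s) := by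
  have hsB : s ᵥ* B = B *ᵥ s := by
    conv_lhs => rw [← hB]
    rw [Matrix.vecMul_transpose]
  simp only [bfgsUpdate, Matrix.mul_vecMulVec, Matrix.vecMulVec_mul, hsB, Matrix.trace_add,
    Matrix.trace_sub, Matrix.trace_smul, Matrix.trace_vecMulVec, smul_eq_mul]
  ring

/-- The potential `tr B - log det B`, nonnegative on positive definite matrices, which penalizes
both large and small eigenvalues. -/
noncomputable def traceLogDet {n : ℕ} (B : Matrix (Fin n) (Fin n) ℝ) : ℝ :=
  B.trace - Real.log B.det

theorem traceLogDet_nonneg {n : ℕ} {B : Matrix (Fin n) (Fin n) ℝ} (hB : B.PosDef) :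
    0 ≤ traceLogDet B := by
  have htr := hB.isHermitian.trace_eq_sum_eigenvalues
  have hdet := hB.isHermitian.det_eq_prod_eigenvalues
  simp only [RCLike.ofReal_real_eq_id, id_eq] at htr hdet
  rw [traceLogDet, htr, hdet, Real.log_prod (fun i _ => (hB.eigenvalues_pos i).ne'),
    ← Finset.sum_sub_distrib]
  refine Finset.sum_nonneg fun i _ => ?_
  have := Real.log_le_sub_one_of_pos (hB.eigenvalues_pos i)
  linarith

theorem traceLogDet_bfgsUpdate {n : ℕ} {B : Matrix (Fin n) (Fin n) ℝ} (hB : B.PosDef)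
    {s γ : Fin n → ℝ} (hs : 0 < s ⬝ᵥ (B *ᵥ s)) (hγ : 0 < γ ⬝ᵥ s) :
    traceLogDet (bfgsUpdate B s γ) = traceLogDet B
      - ((B *ᵥ s) ⬝ᵥ (B *ᵥ s)) / (s ⬝ᵥ (B *ᵥ s)) + (γ ⬝ᵥ γ) / (γ ⬝ᵥ s)
      - Real.log ((γ ⬝ᵥ s) / (s ⬝ᵥ (B *ᵥ s))) := by
  have hT : Bᵀ = B := by simpa using hB.isHermitian.eq
  rw [traceLogDet, traceLogDet, trace_bfgsUpdate hT, det_bfgsUpdate hT hs hγ,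
    Real.log_mul hB.det_pos.ne' (div_pos hγ hs).ne']
  ring

/-- The defect `‖B s‖² / (sᵀ B s) - log (sᵀ B s / ‖s‖²)` of `B` along `s`. It depends only on the
direction of `s`, and a bound on it bounds `‖B s‖ / ‖s‖` above and `sᵀ B s / ‖s‖²` below. -/
noncomputable def bfgsDefect {n : ℕ} (B : Matrix (Fin n) (Fin n) ℝ) (s : Fin n → ℝ) : ℝ :=
  ((B *ᵥ s) ⬝ᵥ (B *ᵥ s)) / (s ⬝ᵥ (B *ᵥ s)) - Real.log ((s ⬝ᵥ (B *ᵥ s)) / (s ⬝ᵥ s))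

theorem bfgsDefect_smul {n : ℕ} (B : Matrix (Fin n) (Fin n) ℝ) (s : Fin n → ℝ) {t : ℝ}
    (ht : t ≠ 0) : bfgsDefect B (t • s) = bfgsDefect B s := by
  simp only [bfgsDefect, Matrix.mulVec_smul, dotProduct_smul, smul_dotProduct, smul_eq_mul,
    mul_div_mul_left _ _ ht]

theorem traceLogDet_bfgsUpdate_le {n : ℕ} {B : Matrix (Fin n) (Fin n) ℝ} (hB : B.PosDef)
    {s γ : Fin n → ℝ} (hs : s ≠ 0) {c M : ℝ} (hc : 0 < c)
    (hγ : c * (s ⬝ᵥ s) ≤ γ ⬝ᵥ s) (hM : γ ⬝ᵥ γ ≤ M * (s ⬝ᵥ s)) :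
    traceLogDet (bfgsUpdate B s γ) ≤ traceLogDet B - bfgsDefect B s + (M / c - Real.log c) := by
  have hβ : 0 < s ⬝ᵥ (B *ᵥ s) := by simpa using hB.dotProduct_mulVec_pos hs
  have hN : 0 < s ⬝ᵥ s := by simpa using Matrix.PosDef.one.dotProduct_mulVec_pos hs
  have hγ0 : 0 < γ ⬝ᵥ s := lt_of_lt_of_le (by positivity) hγ
  rw [traceLogDet_bfgsUpdate hB hβ hγ0, bfgsDefect, Real.log_div hγ0.ne' hβ.ne',
    Real.log_div hβ.ne' hN.ne']
  have h1 : (γ ⬝ᵥ γ) / (γ ⬝ᵥ s) ≤ M / c := by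
    rw [div_le_div_iff₀ hγ0 hc]
    have hγγ : 0 ≤ γ ⬝ᵥ γ := by simpa using dotProduct_star_self_nonneg γ
    have hM0 : 0 ≤ M := nonneg_of_mul_nonneg_left (hγγ.trans hM) hN
    nlinarith [mul_le_mul_of_nonneg_left hγ hM0]
  have h2 : Real.log c + Real.log (s ⬝ᵥ s) ≤ Real.log (γ ⬝ᵥ s) := by
    rw [← Real.log_mul hc.ne' hN.ne']
    exact Real.log_le_log (by positivity) hγ
  linarith

/-- Cauchy–Schwarz, in the form `sᵀ B s / ‖s‖² ≤ ‖B s‖² / (sᵀ B s)`. -/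
theorem rayleigh_le {n : ℕ} {B : Matrix (Fin n) (Fin n) ℝ} {s : Fin n → ℝ}
    (hβ : 0 < s ⬝ᵥ (B *ᵥ s)) (hN : 0 < s ⬝ᵥ s) :
    (s ⬝ᵥ (B *ᵥ s)) / (s ⬝ᵥ s) ≤ ((B *ᵥ s) ⬝ᵥ (B *ᵥ s)) / (s ⬝ᵥ (B *ᵥ s)) := by
  rw [div_le_div_iff₀ hN hβ]
  have := Finset.sum_mul_sq_le_sq_mul_sq Finset.univ s (B *ᵥ s)
  simp only [dotProduct, ← sq] at *
  linarith

theorem bfgsDefect_nonneg {n : ℕ} {B : Matrix (Fin n) (Fin n) ℝ} (hB : B.PosDef)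
    {s : Fin n → ℝ} (hs : s ≠ 0) : 0 ≤ bfgsDefect B s := by
  have hβ : 0 < s ⬝ᵥ (B *ᵥ s) := by simpa using hB.dotProduct_mulVec_pos hs
  have hN : 0 < s ⬝ᵥ s := by simpa using Matrix.PosDef.one.dotProduct_mulVec_pos hs
  have h1 := rayleigh_le hβ hN
  have h2 := Real.log_le_sub_one_of_pos (div_pos hβ hN)
  rw [bfgsDefect]
  linarith

theorem rayleigh_ge_of_bfgsDefect_le {n : ℕ} {B : Matrix (Fin n) (Fin n) ℝ} (hB : B.PosDef)
    {s : Fin n → ℝ} (hs : s ≠ 0) {C : ℝ} (hC : bfgsDefect B s ≤ C) :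
    Real.exp (-C) * (s ⬝ᵥ s) ≤ s ⬝ᵥ (B *ᵥ s) := by
  have hβ : 0 < s ⬝ᵥ (B *ᵥ s) := by simpa using hB.dotProduct_mulVec_pos hs
  have hN : 0 < s ⬝ᵥ s := by simpa using Matrix.PosDef.one.dotProduct_mulVec_pos hs
  have h1 := (div_pos hβ hN).trans_le (rayleigh_le hβ hN)
  rw [bfgsDefect] at hC
  rw [← le_div_iff₀ hN, ← Real.le_log_iff_exp_le (div_pos hβ hN)]
  linarith

theorem mulVec_sq_le_of_bfgsDefect_le {n : ℕ} {B : Matrix (Fin n) (Fin n) ℝ} (hB : B.PosDef)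
    {s : Fin n → ℝ} (hs : s ≠ 0) {C : ℝ} (hC : bfgsDefect B s ≤ C) :
    (B *ᵥ s) ⬝ᵥ (B *ᵥ s) ≤ (2 * C) ^ 2 * (s ⬝ᵥ s) := by
  have hβ : 0 < s ⬝ᵥ (B *ᵥ s) := by simpa using hB.dotProduct_mulVec_pos hs
  have hN : 0 < s ⬝ᵥ s := by simpa using Matrix.PosDef.one.dotProduct_mulVec_pos hs
  have hqa := rayleigh_le hβ hN
  have hq := div_pos hβ hN
  have hW : (B *ᵥ s) ⬝ᵥ (B *ᵥ s) = ((B *ᵥ s) ⬝ᵥ (B *ᵥ s)) / (s ⬝ᵥ (B *ᵥ s)) *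
      ((s ⬝ᵥ (B *ᵥ s)) / (s ⬝ᵥ s)) * (s ⬝ᵥ s) := by field_simp
  rw [bfgsDefect] at hC
  rw [hW]
  generalize ((B *ᵥ s) ⬝ᵥ (B *ᵥ s)) / (s ⬝ᵥ (B *ᵥ s)) = a at *
  generalize (s ⬝ᵥ (B *ᵥ s)) / (s ⬝ᵥ s) = q at *
  have ha : 0 < a := hq.trans_le hqa
  have h1 : Real.log q ≤ Real.log a := Real.log_le_log hq hqa
  -- `log a ≤ a / 2`, from `log (a / 2) ≤ a / 2 - 1` and `log 2 ≤ 1`.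
  have h2 : Real.log a ≤ a / 2 := by
    have h3 := Real.log_le_sub_one_of_pos (half_pos ha)
    have h4 := Real.log_le_sub_one_of_pos (zero_lt_two' ℝ)
    rw [Real.log_div ha.ne' two_ne_zero] at h3
    linarith
  have h5 : a ≤ 2 * C := by linarith
  have h6 : a * q ≤ (2 * C) ^ 2 := by nlinarith
  exact mul_le_mul_of_nonneg_right h6 hN.le

/-! ### Gradients, Pareto criticality and the direction subproblem -/

theorem inner_eq_dotProduct {n : ℕ} (x y : EuclideanSpace ℝ (Fin n)) :
    inner ℝ x y = x.ofLp ⬝ᵥ y.ofLp := by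
  rw [EuclideanSpace.inner_eq_star_dotProduct, star_trivial, dotProduct_comm]

theorem norm_sq_eq_dotProduct {n : ℕ} (x : EuclideanSpace ℝ (Fin n)) :
    ‖x‖ ^ 2 = x.ofLp ⬝ᵥ x.ofLp := by
  rw [← real_inner_self_eq_norm_sq, inner_eq_dotProduct]

section

variable {n m : ℕ} {F : EuclideanSpace ℝ (Fin n) → EuclideanSpace ℝ (Fin m)}

theorem inner_grad (hF : Differentiable ℝ F) (j : Fin m) (x v : EuclideanSpace ℝ (Fin n)) :
    inner ℝ (grad F j x) v = fderiv ℝ F x v j := by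
  have h : HasFDerivAt (fun z => F z j)
      ((EuclideanSpace.proj j : EuclideanSpace ℝ (Fin m) →L[ℝ] ℝ).comp (fderiv ℝ F x)) x :=
    (EuclideanSpace.proj j : EuclideanSpace ℝ (Fin m) →L[ℝ] ℝ).hasFDerivAt.comp x
      (hF x).hasFDerivAt
  rw [grad, inner_gradient_left, h.fderiv]
  rfl

theorem not_isParetoCritical_iff (hF : Differentiable ℝ F) (x : EuclideanSpace ℝ (Fin n)) :
    ¬ IsParetoCritical F x ↔ ∃ v, ∀ j, inner ℝ (grad F j x) v < 0 := by
  rw [IsParetoCritical, ← Ne, ← Set.nonempty_iff_ne_empty]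
  constructor
  · rintro ⟨_, hw, v, rfl⟩
    exact ⟨v, fun j => by rw [inner_grad hF]; exact hw j⟩
  · rintro ⟨v, hv⟩
    exact ⟨_, fun j => by rw [← inner_grad hF]; exact hv j, v, rfl⟩

theorem continuous_grad (hF : ContDiff ℝ 1 F) (j : Fin m) : Continuous (grad F j) := by
  have h : ContDiff ℝ 1 fun z => F z j :=
    (EuclideanSpace.proj j : EuclideanSpace ℝ (Fin m) →L[ℝ] ℝ).contDiff.comp hF
  exact (InnerProductSpace.toDual ℝ _).symm.continuous.comp (h.continuous_fderiv one_ne_zero)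

theorem inner_le_maxDeriv (x d : EuclideanSpace ℝ (Fin n)) (j : Fin m) :
    inner ℝ (grad F j x) d ≤ maxDeriv F x d :=
  le_ciSup (f := fun j : Fin m => inner ℝ (grad F j x) d) (Set.finite_range _).bddAbove j

theorem maxDeriv_smul {t : ℝ} (ht : 0 ≤ t) (x d : EuclideanSpace ℝ (Fin n)) :
    maxDeriv F x (t • d) = t * maxDeriv F x d := by
  simp only [maxDeriv, inner_smul_right]
  exact (Real.mul_iSup_of_nonneg ht _).symm

/-- First-order optimality for the direction subproblem: at a minimizer `d` no direction `v` is a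
descent direction for all the quadratic models at once. -/
theorem exists_nonneg_of_isMinOn (hm : 0 < m) {B : Fin m → Matrix (Fin n) (Fin n) ℝ}
    (hB : ∀ j, (B j).PosDef) {x d : EuclideanSpace ℝ (Fin n)}
    (hd : IsMinOn (subObjective F B x) Set.univ d) (v : EuclideanSpace ℝ (Fin n)) :
    ∃ j, 0 ≤ inner ℝ (grad F j x) v + v.ofLp ⬝ᵥ (B j *ᵥ d.ofLp) := by
  have : Nonempty (Fin m) := ⟨⟨0, hm⟩⟩
  by_contra! hneg
  have hev : ∀ᶠ t : ℝ in 𝓝[>] 0, ∀ j, inner ℝ (grad F j x) v + v.ofLp ⬝ᵥ (B j *ᵥ d.ofLp)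
      + t * ((1 / 2) * (v.ofLp ⬝ᵥ (B j *ᵥ v.ofLp))) < 0 := by
    refine eventually_all.mpr fun j => nhdsWithin_le_nhds ?_
    have hc : ContinuousAt (fun t : ℝ => inner ℝ (grad F j x) v + v.ofLp ⬝ᵥ (B j *ᵥ d.ofLp)
      + t * ((1 / 2) * (v.ofLp ⬝ᵥ (B j *ᵥ v.ofLp)))) 0 := by fun_prop
    exact hc.eventually_lt continuousAt_const (by simpa using hneg j)
  obtain ⟨t, ht, ht0⟩ := (hev.and self_mem_nhdsWithin).exists
  have ht0 : 0 < t := ht0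
  obtain ⟨j, hj⟩ := exists_eq_ciSup_of_finite (f := fun j : Fin m =>
    inner ℝ (grad F j x) (d + t • v) + (1 / 2) *
      ((d + t • v).ofLp ⬝ᵥ (B j *ᵥ (d + t • v).ofLp)))
  have hmin : subObjective F B x d ≤ subObjective F B x (d + t • v) := hd (Set.mem_univ _)
  have hle := le_subObjective F B x d j
  have hj' : inner ℝ (grad F j x) (d + t • v) + (1 / 2) *
      ((d + t • v).ofLp ⬝ᵥ (B j *ᵥ (d + t • v).ofLp)) = subObjective F B x (d + t • v) := hj
  have hsymm : d.ofLp ⬝ᵥ (B j *ᵥ v.ofLp) = v.ofLp ⬝ᵥ (B j *ᵥ d.ofLp) := by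
    have hT : (B j)ᵀ = B j := by simpa using (hB j).isHermitian.eq
    rw [Matrix.dotProduct_mulVec, ← hT, Matrix.vecMul_transpose, hT, dotProduct_comm]
  simp only [WithLp.ofLp_smul, WithLp.ofLp_add, Matrix.mulVec_smul,
    Matrix.mulVec_add, dotProduct_smul, smul_dotProduct, smul_eq_mul,
    dotProduct_add, add_dotProduct, inner_smul_right, inner_add_right, hsymm] at hj'
  nlinarith [mul_neg_of_pos_of_neg ht0 (ht j)]

theorem isMinOn_searchDir (hm : 0 < m) {B : Fin m → Matrix (Fin n) (Fin n) ℝ}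
    (hB : ∀ j, (B j).PosDef) (x : EuclideanSpace ℝ (Fin n)) :
    IsMinOn (subObjective F B x) Set.univ (searchDir F B x) :=
  (isMinOn_iff_eq_searchDir hm F B hB x _).mpr rfl

theorem searchDir_ne_zero (hm : 0 < m) (hF : Differentiable ℝ F)
    {B : Fin m → Matrix (Fin n) (Fin n) ℝ} (hB : ∀ j, (B j).PosDef)
    {x : EuclideanSpace ℝ (Fin n)} (hx : ¬ IsParetoCritical F x) : searchDir F B x ≠ 0 := by
  intro h0
  obtain ⟨v, hv⟩ := (not_isParetoCritical_iff hF x).mp hx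
  obtain ⟨j, hj⟩ := exists_nonneg_of_isMinOn hm hB (isMinOn_searchDir (F := F) hm hB x) v
  rw [h0] at hj
  simp only [WithLp.ofLp_zero, Matrix.mulVec_zero, dotProduct_zero, add_zero] at hj
  exact (hv j).not_ge hj

/-- The optimal value of the subproblem is nonpositive, so uniform coercivity of the models along
the search direction turns into descent. -/
theorem maxDeriv_searchDir_le (hm : 0 < m) {B : Fin m → Matrix (Fin n) (Fin n) ℝ}
    (hB : ∀ j, (B j).PosDef) (x : EuclideanSpace ℝ (Fin n)) {c : ℝ}
    (hc : ∀ j, c * ‖searchDir F B x‖ ^ 2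
      ≤ (searchDir F B x).ofLp ⬝ᵥ (B j *ᵥ (searchDir F B x).ofLp)) :
    maxDeriv F x (searchDir F B x) ≤ -(c / 2 * ‖searchDir F B x‖ ^ 2) := by
  have : Nonempty (Fin m) := ⟨⟨0, hm⟩⟩
  have hmin : subObjective F B x (searchDir F B x) ≤ subObjective F B x 0 :=
    isMinOn_searchDir hm hB x (Set.mem_univ 0)
  have h0 : subObjective F B x 0 = 0 := by simp [subObjective]
  refine ciSup_le fun j => ?_
  have h1 := le_subObjective F B x (searchDir F B x) j
  have h2 := hc j
  linarith

/-- The identity `𝒟(x, d_SD(x)) = -‖d_SD(x)‖²`, from optimality of `t = 1` among the multiples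
`t • d_SD(x)`, `t ≥ 0`. -/
theorem maxDeriv_steepestDir (hm : 0 < m) (x : EuclideanSpace ℝ (Fin n)) :
    maxDeriv F x (steepestDir F x) = -‖steepestDir F x‖ ^ 2 := by
  set d := steepestDir F x
  have hmin : ∀ t : ℝ, 0 ≤ t → maxDeriv F x d + (1 / 2) * ‖d‖ ^ 2
      ≤ t * maxDeriv F x d + (1 / 2) * (t ^ 2 * ‖d‖ ^ 2) := by
    intro t ht
    have h : subObjective F (fun _ => 1) x d ≤ subObjective F (fun _ => 1) x (t • d) :=
      isMinOn_searchDir hm (fun _ => Matrix.PosDef.one) x (Set.mem_univ _)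
    rwa [subObjective_one hm, subObjective_one hm, maxDeriv_smul ht, norm_smul, mul_pow,
      Real.norm_eq_abs, sq_abs] at h
  have h0 := hmin 0 le_rfl
  rcases eq_or_ne d 0 with h | h
  · simp [h, maxDeriv]
  · have hN : 0 < ‖d‖ ^ 2 := by positivity
    -- The quadratic in `t` has its vertex at `t = -𝒟 / ‖d‖²`.
    have h1 := hmin (-maxDeriv F x d / ‖d‖ ^ 2) (div_nonneg (by nlinarith) hN.le)
    generalize maxDeriv F x d = D at *
    generalize ‖d‖ ^ 2 = N at *
    have h2 : -D / N * D + 1 / 2 * ((-D / N) ^ 2 * N) = -(D ^ 2 / (2 * N)) := by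
      field_simp; ring
    have h3 : D ^ 2 / (2 * N) * (2 * N) = D ^ 2 := by field_simp
    have h4 : (D + N) ^ 2 ≤ 0 := by nlinarith
    have h5 : D + N = 0 := pow_eq_zero_iff two_ne_zero |>.mp (le_antisymm h4 (sq_nonneg _))
    linarith

theorem inner_grad_steepestDir_le (hm : 0 < m) (x : EuclideanSpace ℝ (Fin n)) (j : Fin m) :
    inner ℝ (grad F j x) (steepestDir F x) ≤ -‖steepestDir F x‖ ^ 2 :=
  (inner_le_maxDeriv x _ j).trans (maxDeriv_steepestDir hm x).le

/-- The steepest descent direction is no longer than any convex combination of the gradients. -/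
theorem norm_steepestDir_le_norm_sum (hm : 0 < m) (x : EuclideanSpace ℝ (Fin n)) {μ : Fin m → ℝ}
    (hμ : μ ∈ stdSimplex ℝ (Fin m)) : ‖steepestDir F x‖ ≤ ‖∑ i, μ i • grad F i x‖ := by
  have h1 : inner ℝ (∑ i, μ i • grad F i x) (steepestDir F x) ≤ -‖steepestDir F x‖ ^ 2 := by
    rw [sum_inner]
    calc ∑ i, inner ℝ (μ i • grad F i x) (steepestDir F x)
        ≤ ∑ i, μ i * (-‖steepestDir F x‖ ^ 2) := by
          refine Finset.sum_le_sum fun i _ => ?_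
          rw [real_inner_smul_left]
          exact mul_le_mul_of_nonneg_left (inner_grad_steepestDir_le hm x i) (hμ.1 i)
      _ = _ := by rw [← Finset.sum_mul, hμ.2, one_mul]
  have h2 := (abs_le.mp (abs_real_inner_le_norm (∑ i, μ i • grad F i x) (steepestDir F x))).1
  by_contra! h
  nlinarith [norm_nonneg (∑ i, μ i • grad F i x)]

/-- Upper bounds on the matrices along the search direction make it at least as long as a fixed
fraction of the steepest descent direction. -/
theorem norm_steepestDir_le_mul_norm_searchDir (hm : 0 < m)
    {B : Fin m → Matrix (Fin n) (Fin n) ℝ} (hB : ∀ j, (B j).PosDef)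
    (x : EuclideanSpace ℝ (Fin n)) {M : ℝ} (hM : 0 ≤ M)
    (hBd : ∀ j, (B j *ᵥ (searchDir F B x).ofLp) ⬝ᵥ (B j *ᵥ (searchDir F B x).ofLp)
      ≤ M ^ 2 * ‖searchDir F B x‖ ^ 2) :
    ‖steepestDir F x‖ ≤ M * ‖searchDir F B x‖ := by
  obtain ⟨j, hj⟩ := exists_nonneg_of_isMinOn hm hB (isMinOn_searchDir (F := F) hm hB x)
    (steepestDir F x)
  have h1 := inner_grad_steepestDir_le (F := F) hm x j
  have h2 : ‖WithLp.toLp 2 (B j *ᵥ (searchDir F B x).ofLp)‖ ≤ M * ‖searchDir F B x‖ := by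
    refine abs_le_of_sq_le_sq' ?_ (by positivity) |>.2
    rw [norm_sq_eq_dotProduct, mul_pow]
    exact hBd j
  have h3 := real_inner_le_norm (steepestDir F x)
    (WithLp.toLp 2 (B j *ᵥ (searchDir F B x).ofLp))
  rw [inner_eq_dotProduct] at h3
  by_contra! h
  have h4 : 0 < ‖steepestDir F x‖ := lt_of_le_of_lt (by positivity) h
  nlinarith

/-- Points whose steepest descent directions tend to zero can only converge to a Pareto critical
point. -/
theorem isParetoCritical_of_tendsto (hm : 0 < m) (hF : ContDiff ℝ 1 F)
    {u : ℕ → EuclideanSpace ℝ (Fin n)} {a : EuclideanSpace ℝ (Fin n)}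
    (hu : Tendsto u atTop (𝓝 a)) (hd : Tendsto (fun k => ‖steepestDir F (u k)‖) atTop (𝓝 0)) :
    IsParetoCritical F a := by
  by_contra hcrit
  obtain ⟨v, hv⟩ := (not_isParetoCritical_iff (hF.differentiable one_ne_zero) a).mp hcrit
  have hlim : ∀ j, Tendsto
      (fun k => inner ℝ (grad F j (u k)) v + ‖v‖ * ‖steepestDir F (u k)‖) atTop
      (𝓝 (inner ℝ (grad F j a) v + ‖v‖ * 0)) := fun j =>
    ((((continuous_grad hF j).tendsto a).comp hu).inner tendsto_const_nhds).add
      (hd.const_mul _)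
  have hev : ∀ᶠ k in atTop, ∀ j,
      inner ℝ (grad F j (u k)) v + ‖v‖ * ‖steepestDir F (u k)‖ < 0 :=
    eventually_all.mpr fun j => (hlim j).eventually_lt_const (by simpa using hv j)
  obtain ⟨k, hk⟩ := hev.exists
  have hB : ∀ _ : Fin m, (1 : Matrix (Fin n) (Fin n) ℝ).PosDef := fun _ => Matrix.PosDef.one
  obtain ⟨j, hj⟩ := exists_nonneg_of_isMinOn hm hB (isMinOn_searchDir (F := F) hm hB (u k)) v
  rw [Matrix.one_mulVec, ← inner_eq_dotProduct] at hj
  have h1 := real_inner_le_norm v (steepestDir F (u k))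
  have h2 := hk j
  rw [steepestDir] at h1 h2
  linarith

end

/-! ### The corrected gradient differences -/

section

variable {n m : ℕ} {F : EuclideanSpace ℝ (Fin n) → EuclideanSpace ℝ (Fin m)}

/-- The correction makes the curvature along the step at least `ϑ ‖∑ᵢ μᵢ ∇Fᵢ(x)‖`, whatever the
sign of the curvature of `F_j`. -/
theorem le_inner_gammaVec (μ : Fin m → ℝ) (ϑ : ℝ) {x x' : EuclideanSpace ℝ (Fin n)}
    (hx : x' - x ≠ 0) (j : Fin m) :
    ϑ * ‖∑ i, μ i • grad F i x‖ * ‖x' - x‖ ^ 2 ≤ inner ℝ (gammaVec F μ ϑ x x' j) (x' - x) := by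
  have hN : 0 < ‖x' - x‖ ^ 2 := by positivity
  rw [gammaVec, inner_add_left, real_inner_smul_left, real_inner_self_eq_norm_sq, correction]
  have h1 := le_max_left (-(inner ℝ (grad F j x' - grad F j x) (x' - x) / ‖x' - x‖ ^ 2)) 0
  have h2 := mul_le_mul_of_nonneg_right h1 hN.le
  rw [neg_mul, div_mul_cancel₀ _ hN.ne'] at h2
  linarith

theorem norm_gammaVec_le (μ : Fin m → ℝ) {ϑ L : ℝ} (hϑ : 0 ≤ ϑ) (hL : 0 ≤ L)
    {x x' : EuclideanSpace ℝ (Fin n)} {j : Fin m} (hx : x' - x ≠ 0)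
    (hy : ‖grad F j x' - grad F j x‖ ≤ L * ‖x' - x‖) :
    ‖gammaVec F μ ϑ x x' j‖ ≤ (2 * L + ϑ * ‖∑ i, μ i • grad F i x‖) * ‖x' - x‖ := by
  have hN : 0 < ‖x' - x‖ ^ 2 := by positivity
  have h1 : -(inner ℝ (grad F j x' - grad F j x) (x' - x) / ‖x' - x‖ ^ 2) ≤ L := by
    rw [← neg_div, div_le_iff₀ hN]
    have h := (abs_le.mp (abs_real_inner_le_norm (grad F j x' - grad F j x) (x' - x))).1
    have h' := mul_le_mul_of_nonneg_right hy (norm_nonneg (x' - x))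
    linarith
  have h2 : 0 ≤ correction F μ ϑ x x' j :=
    add_nonneg (le_max_right _ _) (mul_nonneg hϑ (norm_nonneg _))
  have h3 : correction F μ ϑ x x' j ≤ L + ϑ * ‖∑ i, μ i • grad F i x‖ :=
    add_le_add_left (max_le h1 hL) _
  calc ‖gammaVec F μ ϑ x x' j‖
      ≤ ‖grad F j x' - grad F j x‖ + ‖correction F μ ϑ x x' j • (x' - x)‖ := norm_add_le _ _
    _ = ‖grad F j x' - grad F j x‖ + correction F μ ϑ x x' j * ‖x' - x‖ := by
        rw [norm_smul, Real.norm_of_nonneg h2]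
    _ ≤ L * ‖x' - x‖ + (L + ϑ * ‖∑ i, μ i • grad F i x‖) * ‖x' - x‖ := by gcongr
    _ = _ := by ring

/-! ### Compactness of the level set and runs of the algorithm -/

theorem isCompact_levelSet (hF : Continuous F) {x₀ : EuclideanSpace ℝ (Fin n)}
    (hbdd : Bornology.IsBounded (levelSet F x₀)) : IsCompact (levelSet F x₀) := by
  refine Metric.isCompact_of_isClosed_isBounded ?_ hbdd
  have h : levelSet F x₀ = ⋂ j, {x | F x j ≤ F x₀ j} := by
    ext x
    simp [levelSet]
  rw [h]
  exact isClosed_iInter fun j => isClosed_le (by fun_prop) continuous_const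

namespace IsRun

variable {ρ σ ϑlo ϑhi : ℝ} {x₀ : EuclideanSpace ℝ (Fin n)}
  {x d : ℕ → EuclideanSpace ℝ (Fin n)} {α : ℕ → ℝ}
  {B : ℕ → Fin m → Matrix (Fin n) (Fin n) ℝ} {μ : ℕ → Fin m → ℝ} {ϑ : ℕ → ℝ}

theorem step_eq (hrun : IsRun F ρ σ ϑlo ϑhi x₀ x d α B μ ϑ) (k : ℕ) :
    x (k + 1) - x k = α k • d k := by
  rw [hrun.next, add_sub_cancel_left]

theorem direction_ne_zero (hrun : IsRun F ρ σ ϑlo ϑhi x₀ x d α B μ ϑ) (hm : 0 < m)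
    (hF : Differentiable ℝ F) {k : ℕ} (hB : ∀ j, (B k j).PosDef) : d k ≠ 0 := by
  rw [hrun.direction]
  exact searchDir_ne_zero hm hF hB (hrun.not_critical k)

theorem step_ne_zero (hrun : IsRun F ρ σ ϑlo ϑhi x₀ x d α B μ ϑ) (hm : 0 < m)
    (hF : Differentiable ℝ F) {k : ℕ} (hB : ∀ j, (B k j).PosDef) : x (k + 1) - x k ≠ 0 := by
  rw [hrun.step_eq]
  exact smul_ne_zero (hrun.step_pos k).ne' (hrun.direction_ne_zero hm hF hB)

theorem norm_sum_pos (hrun : IsRun F ρ σ ϑlo ϑhi x₀ x d α B μ ϑ) (hm : 0 < m)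
    (hF : Differentiable ℝ F) (k : ℕ) : 0 < ‖∑ i, μ k i • grad F i (x k)‖ :=
  (norm_pos_iff.mpr (searchDir_ne_zero hm hF (fun _ => Matrix.PosDef.one)
    (hrun.not_critical k))).trans_le (norm_steepestDir_le_norm_sum hm _ (hrun.multiplier_mem k))

theorem posDef (hrun : IsRun F ρ σ ϑlo ϑhi x₀ x d α B μ ϑ) (hm : 0 < m)
    (hF : Differentiable ℝ F) (hϑlo : 0 < ϑlo) (k : ℕ) : ∀ j, (B k j).PosDef := by
  induction k with
  | zero => exact hrun.posDef_zero
  | succ k ih =>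
    intro j
    have hs := hrun.step_ne_zero hm hF ih
    have hs' : (x (k + 1) - x k).ofLp ≠ 0 := fun h => hs ((WithLp.ofLp_eq_zero 2).mp h)
    rw [hrun.update]
    refine posDef_bfgsUpdate (ih j) (by simpa using (ih j).dotProduct_mulVec_pos hs') ?_
    rw [← inner_eq_dotProduct]
    refine lt_of_lt_of_le ?_ (le_inner_gammaVec (μ k) (ϑ k) hs j)
    have h1 := hrun.norm_sum_pos hm hF k
    have h2 := hϑlo.trans_le (hrun.scaling_mem k).1
    positivity

theorem maxDeriv_neg (hrun : IsRun F ρ σ ϑlo ϑhi x₀ x d α B μ ϑ) (hm : 0 < m)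
    (hF : Differentiable ℝ F) (hϑlo : 0 < ϑlo) (k : ℕ) : maxDeriv F (x k) (d k) < 0 := by
  have : Nonempty (Fin m) := ⟨⟨0, hm⟩⟩
  have hB := hrun.posDef hm hF hϑlo k
  have hd := hrun.direction_ne_zero hm hF hB
  choose c hc hcd using fun j => exists_coercive (hB j)
  obtain ⟨i, hi⟩ := Finite.exists_min c
  have h1 := maxDeriv_searchDir_le (F := F) hm hB (x k) (c := c i) fun j =>
    (mul_le_mul_of_nonneg_right (hi j) (sq_nonneg _)).trans (hcd j _)
  rw [← hrun.direction] at h1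
  have h2 : 0 < ‖d k‖ := norm_pos_iff.mpr hd
  have h3 : 0 < c i / 2 * ‖d k‖ ^ 2 := mul_pos (half_pos (hc i)) (by positivity)
  linarith

theorem objective_succ_le (hrun : IsRun F ρ σ ϑlo ϑhi x₀ x d α B μ ϑ) (k : ℕ) (j : Fin m) :
    F (x (k + 1)) j ≤ F (x k) j + ρ * α k * maxDeriv F (x k) (d k) := by
  rw [hrun.next]
  exact hrun.wolfe_decrease k j

theorem antitone_objective (hrun : IsRun F ρ σ ϑlo ϑhi x₀ x d α B μ ϑ) (hm : 0 < m)
    (hF : Differentiable ℝ F) (hϑlo : 0 < ϑlo) (hρ : 0 < ρ) (j : Fin m) :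
    Antitone fun k => F (x k) j := by
  refine antitone_nat_of_succ_le fun k => ?_
  have h1 := hrun.objective_succ_le k j
  have h2 := mul_neg_of_pos_of_neg (mul_pos hρ (hrun.step_pos k))
    (hrun.maxDeriv_neg hm hF hϑlo k)
  linarith

theorem mem_levelSet (hrun : IsRun F ρ σ ϑlo ϑhi x₀ x d α B μ ϑ) (hm : 0 < m)
    (hF : Differentiable ℝ F) (hϑlo : 0 < ϑlo) (hρ : 0 < ρ) (k : ℕ) :
    x k ∈ levelSet F x₀ := fun j => by
  rw [← hrun.start]
  exact hrun.antitone_objective hm hF hϑlo hρ j (Nat.zero_le k)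

/-- The curvature condition bounds the step size below:
`(1 - σ) |𝒟(xᵏ, dᵏ)| ≤ L αₖ ‖dᵏ‖²`. -/
theorem neg_maxDeriv_le (hrun : IsRun F ρ σ ϑlo ϑhi x₀ x d α B μ ϑ) (hm : 0 < m) {L : ℝ} {k : ℕ}
    (hL : ∀ j, ‖grad F j (x (k + 1)) - grad F j (x k)‖ ≤ L * ‖x (k + 1) - x k‖) :
    (1 - σ) * -maxDeriv F (x k) (d k) ≤ L * α k * ‖d k‖ ^ 2 := by
  have : Nonempty (Fin m) := ⟨⟨0, hm⟩⟩
  obtain ⟨j, hj⟩ := exists_eq_ciSup_of_finite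
    (f := fun j : Fin m => inner ℝ (grad F j (x (k + 1))) (d k))
  have h1 : inner ℝ (grad F j (x (k + 1))) (d k) = maxDeriv F (x (k + 1)) (d k) := hj
  have h2 := hrun.wolfe_curvature k
  rw [← hrun.next, ← h1] at h2
  have h3 := inner_le_maxDeriv (F := F) (x k) (d k) j
  have h4 := real_inner_le_norm (grad F j (x (k + 1)) - grad F j (x k)) (d k)
  rw [inner_sub_left] at h4
  have h5 := mul_le_mul_of_nonneg_right (hL j) (norm_nonneg (d k))
  rw [hrun.step_eq, norm_smul, Real.norm_of_nonneg (hrun.step_pos k).le] at h5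
  nlinarith

/-- The Zoutendijk condition, in the form `𝒟(xᵏ, dᵏ)² / ‖dᵏ‖² → 0`: by the Wolfe conditions each
step decreases every objective by a fixed multiple of this quantity. -/
theorem tendsto_zoutendijk (hrun : IsRun F ρ σ ϑlo ϑhi x₀ x d α B μ ϑ) (hm : 0 < m)
    (hF : ContDiff ℝ 1 F) (hbdd : Bornology.IsBounded (levelSet F x₀)) (hϑlo : 0 < ϑlo)
    (hρ : 0 < ρ) (hσ : σ < 1) {L : ℝ} (hL0 : 0 < L)
    (hL : ∀ k j, ‖grad F j (x (k + 1)) - grad F j (x k)‖ ≤ L * ‖x (k + 1) - x k‖) :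
    Tendsto (fun k => maxDeriv F (x k) (d k) ^ 2 / ‖d k‖ ^ 2) atTop (𝓝 0) := by
  have hFd := hF.differentiable one_ne_zero
  let j₀ : Fin m := ⟨0, hm⟩
  have hbelow : BddBelow (Set.range fun k => F (x k) j₀) := by
    have hc : ContinuousOn (fun z => F z j₀) (levelSet F x₀) :=
      Continuous.continuousOn (by have := hF.continuous; fun_prop)
    refine ((isCompact_levelSet hF.continuous hbdd).image_of_continuousOn hc).bddBelow.mono ?_
    rintro _ ⟨k, rfl⟩
    exact ⟨x k, hrun.mem_levelSet hm hFd hϑlo hρ k, rfl⟩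
  have hlim := tendsto_atTop_ciInf (hrun.antitone_objective hm hFd hϑlo hρ j₀) hbelow
  have hdiff : Tendsto (fun k => (L / (ρ * (1 - σ))) * (F (x k) j₀ - F (x (k + 1)) j₀)) atTop
      (𝓝 0) := by
    simpa using (hlim.sub (hlim.comp (tendsto_add_atTop_nat 1))).const_mul (L / (ρ * (1 - σ)))
  refine squeeze_zero (fun k => by positivity) (fun k => ?_) hdiff
  have hd : 0 < ‖d k‖ ^ 2 := by
    have := hrun.direction_ne_zero hm hFd (hrun.posDef hm hFd hϑlo k)
    positivity
  have h1 := hrun.objective_succ_le k j₀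
  have h2 := hrun.neg_maxDeriv_le hm (hL k)
  have h3 := hrun.maxDeriv_neg hm hFd hϑlo k
  have hσ' : 0 < 1 - σ := by linarith
  generalize maxDeriv F (x k) (d k) = D at *
  have h4 : ρ * (-D * ((1 - σ) * -D)) ≤ ρ * (-D * (L * α k * ‖d k‖ ^ 2)) :=
    mul_le_mul_of_nonneg_left (mul_le_mul_of_nonneg_left h2 (by linarith)) hρ.le
  have h5 : ρ * α k * -D ≤ F (x k) j₀ - F (x (k + 1)) j₀ := by linarith
  rw [div_le_iff₀ hd, div_mul_eq_mul_div, div_mul_eq_mul_div, le_div_iff₀ (by positivity)]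
  have h6 := mul_le_mul_of_nonneg_left h5 (mul_pos hL0 hd).le
  linarith

/-- If the steepest descent directions stay away from zero, then infinitely often the defects of
all the matrices along the search direction are below a fixed bound: otherwise the total potential
`∑ⱼ (tr Bⱼᵏ - log det Bⱼᵏ)` would decrease to `-∞`. -/
theorem exists_frequently_bfgsDefect_le (hrun : IsRun F ρ σ ϑlo ϑhi x₀ x d α B μ ϑ) (hm : 0 < m)
    (hF : Differentiable ℝ F) (hϑlo : 0 < ϑlo) {L G : ℝ} (hL0 : 0 ≤ L)
    (hL : ∀ k j, ‖grad F j (x (k + 1)) - grad F j (x k)‖ ≤ L * ‖x (k + 1) - x k‖)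
    (hG : ∀ k j, ‖grad F j (x k)‖ ≤ G) {ε : ℝ} (hε : 0 < ε)
    (hev : ∀ᶠ k in atTop, ε ≤ ‖steepestDir F (x k)‖) :
    ∃ C, ∃ᶠ k in atTop, ∀ j, bfgsDefect (B k j) (d k).ofLp ≤ C := by
  set c := ϑlo * ε with hc
  have hc0 : 0 < c := mul_pos hϑlo hε
  set M := (2 * L + ϑhi * G) ^ 2 with hM
  set K := M / c - Real.log c with hK
  have hpd := hrun.posDef hm hF hϑlo
  have hdne : ∀ k, (d k).ofLp ≠ 0 := fun k h =>
    hrun.direction_ne_zero hm hF (hpd k) ((WithLp.ofLp_eq_zero 2).mp h)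
  refine ⟨m * K + 1, fun hnot => ?_⟩
  set P : ℕ → ℝ := fun k => ∑ j, traceLogDet (B k j) with hP
  have hP0 : ∀ k, 0 ≤ P k := fun k => Finset.sum_nonneg fun j _ => traceLogDet_nonneg (hpd k j)
  have hdec : ∀ᶠ k in atTop, P (k + 1) ≤ P k - 1 := by
    filter_upwards [hev, hnot] with k hk hnk
    push Not at hnk
    obtain ⟨i, hi⟩ := hnk
    have hstep : ∀ j, traceLogDet (B (k + 1) j)
        ≤ traceLogDet (B k j) - bfgsDefect (B k j) (d k).ofLp + K := by
      intro j
      have hs := hrun.step_ne_zero hm hF (hpd k)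
      have hϑ := hrun.scaling_mem k
      have hϑ0 := hϑlo.trans_le hϑ.1
      have hsum := hk.trans (norm_steepestDir_le_norm_sum (F := F) hm (x k)
        (hrun.multiplier_mem k))
      have hsumG : ‖∑ i, μ k i • grad F i (x k)‖ ≤ G := by
        calc _ ≤ ∑ i, μ k i * G := norm_sum_le_of_le _ fun i _ => by
              rw [norm_smul, Real.norm_of_nonneg ((hrun.multiplier_mem k).1 i)]
              exact mul_le_mul_of_nonneg_left (hG k i) ((hrun.multiplier_mem k).1 i)
          _ = G := by rw [← Finset.sum_mul, (hrun.multiplier_mem k).2, one_mul]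
      have hbd := bfgsDefect_smul (B k j) (d k).ofLp (hrun.step_pos k).ne'
      rw [← WithLp.ofLp_smul, ← hrun.step_eq] at hbd
      rw [← hbd, hrun.update]
      refine traceLogDet_bfgsUpdate_le (hpd k j)
        (fun h => hs ((WithLp.ofLp_eq_zero 2).mp h)) hc0 ?_ ?_
      · rw [← norm_sq_eq_dotProduct, ← inner_eq_dotProduct]
        refine le_trans ?_ (le_inner_gammaVec (μ k) (ϑ k) hs j)
        have := mul_le_mul hϑ.1 hsum hε.le hϑ0.le
        gcongr
      · rw [← norm_sq_eq_dotProduct, ← norm_sq_eq_dotProduct, hM, ← mul_pow]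
        refine pow_le_pow_left₀ (norm_nonneg _) ?_ 2
        refine (norm_gammaVec_le (μ k) hϑ0.le hL0 hs (hL k j)).trans ?_
        have := mul_le_mul hϑ.2 hsumG (norm_nonneg _) (hϑ0.le.trans hϑ.2)
        gcongr
    have h1 : P (k + 1) ≤ P k - ∑ j, bfgsDefect (B k j) (d k).ofLp + m * K := by
      calc P (k + 1) ≤ ∑ j, (traceLogDet (B k j) - bfgsDefect (B k j) (d k).ofLp + K) :=
            Finset.sum_le_sum fun j _ => hstep j
        _ = _ := by simp [hP, Finset.sum_add_distrib, Finset.sum_sub_distrib]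
    have h2 : bfgsDefect (B k i) (d k).ofLp ≤ ∑ j, bfgsDefect (B k j) (d k).ofLp :=
      Finset.single_le_sum (f := fun j => bfgsDefect (B k j) (d k).ofLp)
        (fun j _ => bfgsDefect_nonneg (hpd k j) (hdne k)) (Finset.mem_univ i)
    linarith
  obtain ⟨k₀, hk₀⟩ := eventually_atTop.mp hdec
  have hlin : ∀ l : ℕ, P (k₀ + l) ≤ P k₀ - l := by
    intro l
    induction l with
    | zero => simp
    | succ l ih =>
      have := hk₀ (k₀ + l) (Nat.le_add_right _ _)
      push_cast
      rw [← add_assoc]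
      linarith
  obtain ⟨l, hl⟩ := exists_nat_gt (P k₀)
  linarith [hlin l, hP0 (k₀ + l)]

/-- Along the iterations with bounded defects the Zoutendijk quantity would be bounded below, so
the steepest descent directions cannot stay away from zero. -/
theorem frequently_norm_steepestDir_lt (hrun : IsRun F ρ σ ϑlo ϑhi x₀ x d α B μ ϑ) (hm : 0 < m)
    (hF : ContDiff ℝ 1 F) (hbdd : Bornology.IsBounded (levelSet F x₀)) (hϑlo : 0 < ϑlo)
    (hρ : 0 < ρ) (hσ : σ < 1) {L : ℝ} (hL0 : 0 < L)
    (hL : ∀ k j, ‖grad F j (x (k + 1)) - grad F j (x k)‖ ≤ L * ‖x (k + 1) - x k‖)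
    {ε : ℝ} (hε : 0 < ε) : ∃ᶠ k in atTop, ‖steepestDir F (x k)‖ < ε := by
  intro hnot
  have hev : ∀ᶠ k in atTop, ε ≤ ‖steepestDir F (x k)‖ := hnot.mono fun k hk => not_lt.mp hk
  have hFd := hF.differentiable one_ne_zero
  have hpd := hrun.posDef hm hFd hϑlo
  obtain ⟨G, hG⟩ : ∃ G, ∀ k j, ‖grad F j (x k)‖ ≤ G := by
    choose g hg using fun j => (isCompact_levelSet hF.continuous hbdd).exists_bound_of_continuousOn
      (continuous_grad hF j).continuousOn
    obtain ⟨G, hG⟩ := (Set.finite_range g).bddAbove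
    exact ⟨G, fun k j => (hg j _ (hrun.mem_levelSet hm hFd hϑlo hρ k)).trans (hG ⟨j, rfl⟩)⟩
  obtain ⟨C, hC⟩ := hrun.exists_frequently_bfgsDefect_le hm hFd hϑlo hL0.le hL hG hε hev
  have hdne : ∀ k, d k ≠ 0 := fun k => hrun.direction_ne_zero hm hFd (hpd k)
  have hdne' : ∀ k, (d k).ofLp ≠ 0 := fun k h => hdne k ((WithLp.ofLp_eq_zero 2).mp h)
  have hC0 : 0 ≤ C := by
    obtain ⟨k, hk⟩ := hC.exists
    exact (bfgsDefect_nonneg (hpd k _) (hdne' k)).trans (hk ⟨0, hm⟩)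
  set q := Real.exp (-C) with hq
  have hq0 : 0 < q := Real.exp_pos _
  have hz := hrun.tendsto_zoutendijk hm hF hbdd hϑlo hρ hσ hL0 hL
  -- A good iteration satisfies `ε ≤ 2 C ‖d‖` and `𝒟 ≤ -(q / 2) ‖d‖²`, hence
  -- `(q / 2)² ε² ≤ (2 C)² 𝒟² / ‖d‖²`.
  have hsmall : ∀ᶠ k in atTop,
      (2 * C) ^ 2 * (maxDeriv F (x k) (d k) ^ 2 / ‖d k‖ ^ 2) < (q / 2) ^ 2 * ε ^ 2 :=
    (hz.const_mul ((2 * C) ^ 2)).eventually_lt_const (by rw [mul_zero]; positivity)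
  obtain ⟨k, hk, hεk, hsk⟩ := (hC.and_eventually (hev.and hsmall)).exists
  have h1 : ‖steepestDir F (x k)‖ ≤ 2 * C * ‖d k‖ := by
    have h := norm_steepestDir_le_mul_norm_searchDir (F := F) hm (hpd k) (x k)
      (M := 2 * C) (by positivity)
    rw [← hrun.direction] at h
    refine h fun j => ?_
    rw [norm_sq_eq_dotProduct]
    exact mulVec_sq_le_of_bfgsDefect_le (hpd k j) (hdne' k) (hk j)
  have h2 : maxDeriv F (x k) (d k) ≤ -(q / 2 * ‖d k‖ ^ 2) := by
    have h := maxDeriv_searchDir_le (F := F) hm (hpd k) (x k) (c := q)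
    rw [← hrun.direction] at h
    refine h fun j => ?_
    rw [norm_sq_eq_dotProduct]
    exact rayleigh_ge_of_bfgsDefect_le (hpd k j) (hdne' k) (hk j)
  have hd0 : 0 < ‖d k‖ := norm_pos_iff.mpr (hdne k)
  have h3 : (q / 2) ^ 2 * ‖d k‖ ^ 2 ≤ maxDeriv F (x k) (d k) ^ 2 / ‖d k‖ ^ 2 := by
    rw [le_div_iff₀ (by positivity)]
    have h4 := pow_le_pow_left₀ (by positivity) (le_neg_of_le_neg h2) 2
    linarith
  have h5 : ε ^ 2 ≤ (2 * C * ‖d k‖) ^ 2 := pow_le_pow_left₀ hε.le (hεk.trans h1) 2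
  have h6 := mul_le_mul_of_nonneg_left h3 (sq_nonneg (2 * C))
  have h7 := mul_le_mul_of_nonneg_left h5 (sq_nonneg (q / 2))
  linarith

end IsRun

end

end MOBFGS

theorem mainTheorem1 (n m : ℕ) (hm : 0 < m)
    (F : EuclideanSpace ℝ (Fin n) → EuclideanSpace ℝ (Fin m)) (hF : ContDiff ℝ 1 F)
    (x₀ : EuclideanSpace ℝ (Fin n)) (hbdd : Bornology.IsBounded (MOBFGS.levelSet F x₀))
    (hLip : ∃ (N : Set (EuclideanSpace ℝ (Fin n))) (L : NNReal), IsOpen N ∧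
      MOBFGS.levelSet F x₀ ⊆ N ∧ ∀ j, LipschitzOnWith L (MOBFGS.grad F j) N)
    (ρ σ ϑlo ϑhi : ℝ) (hρ : ρ ∈ Set.Ioo (0 : ℝ) (1 / 2)) (hσ : σ ∈ Set.Ioo ρ 1)
    (hϑlo : 0 < ϑlo) (hϑ : ϑlo ≤ ϑhi)
    (x d : ℕ → EuclideanSpace ℝ (Fin n)) (α : ℕ → ℝ)
    (B : ℕ → Fin m → Matrix (Fin n) (Fin n) ℝ) (μ : ℕ → Fin m → ℝ) (ϑ : ℕ → ℝ)
    (hrun : MOBFGS.IsRun F ρ σ ϑlo ϑhi x₀ x d α B μ ϑ) :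
    liminf (fun k => ((‖MOBFGS.steepestDir F (x k)‖ : ℝ) : EReal)) atTop = 0 ∧
    ∃ (φ : ℕ → ℕ) (xstar : EuclideanSpace ℝ (Fin n)), StrictMono φ ∧
      Tendsto (x ∘ φ) atTop (𝓝 xstar) ∧ MOBFGS.IsParetoCritical F xstar := by
  obtain ⟨N, L, -, hN, hLN⟩ := hLip
  have hmem := hrun.mem_levelSet hm (hF.differentiable one_ne_zero) hϑlo hρ.1
  -- `L + 1` replaces `L` to have a positive constant to divide by.
  have hL : ∀ k j, ‖MOBFGS.grad F j (x (k + 1)) - MOBFGS.grad F j (x k)‖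
      ≤ ((L : ℝ) + 1) * ‖x (k + 1) - x k‖ := fun k j => by
    have h := (hLN j).dist_le_mul _ (hN (hmem (k + 1))) _ (hN (hmem k))
    rw [dist_eq_norm, dist_eq_norm] at h
    linarith [norm_nonneg (x (k + 1) - x k)]
  have hfreq : ∀ ε : ℝ, 0 < ε → ∃ᶠ k in atTop, ‖MOBFGS.steepestDir F (x k)‖ < ε := fun ε hε =>
    hrun.frequently_norm_steepestDir_lt hm hF hbdd hϑlo hρ.1 hσ.2 (by positivity) hL hε
  refine ⟨le_antisymm ?_ ?_, ?_⟩
  · refine EReal.le_of_forall_lt_iff_le.mp fun ε hε => ?_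
    exact liminf_le_of_frequently_le' ((hfreq ε (EReal.coe_pos.mp hε)).mono fun k hk =>
      EReal.coe_le_coe_iff.mpr hk.le)
  · exact le_liminf_of_le (h := Eventually.of_forall fun k =>
      EReal.coe_nonneg.mpr (norm_nonneg _))
  · obtain ⟨φ, hφ, hφd⟩ := extraction_forall_of_frequently
      fun l : ℕ => hfreq (1 / ((l : ℝ) + 1)) (by positivity)
    have hd : Tendsto (fun l => ‖MOBFGS.steepestDir F (x (φ l))‖) atTop (𝓝 0) :=
      squeeze_zero (fun l => norm_nonneg _) (fun l => (hφd l).le)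
        tendsto_one_div_add_atTop_nhds_zero_nat
    obtain ⟨a, -, ψ, hψ, ha⟩ := (MOBFGS.isCompact_levelSet hF.continuous hbdd).tendsto_subseq
      fun l => hmem (φ l)
    exact ⟨φ ∘ ψ, a, hφ.comp hψ, ha,
      MOBFGS.isParetoCritical_of_tendsto hm hF ha (hd.comp hψ.tendsto_atTop)⟩
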